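/- For a partition $\lambda$ of a non-negative integer $N$ (written $\lambda\vdash N$) and a node in row $k$ and column $j$ of its Ferrers--Young diagram, the hook length is $h(k,j)=(\lambda_k-k)+(\lambda'_j-j)+1$, where $\lambda_k$ is the number of nodes in row $k$ and $\lambda'_j$ is the number of nodes in column $j$. For a positive integer $t$, let $\mathcal{H}_t(\lambda)$ be the multiset of those hook lengths of $\lambda$ (one for each node) that are multiples of $t$, and put $$p_t(a,b;N):=\#\{\lambda\vdash N \ :\ \#\mathcal{H}_t(\lambda)\equiv a \pmod b\}.$$ (1) Let $\ell$ be an odd prime and let $0\le a_1,a_2<\ell$ be integers with Legendre symbol $\left(\frac{-16a_1+8a_2+1}{\ell}\right)=-1$. Then $p_2(a_1,\ell;\ell n+a_2)=0$ for every integer $n\ge 0$. (2) Let $\ell\equiv 2\pmod 3$ be a prime (possibly $\ell=2$) and let $0\le a_1,a_2<\ell^2$ be integers with $\mathrm{ord}_\ell(-9a_1+3a_2+1)=1$, where $\mathrm{ord}_\ell(m)$ is the exponent of $\ell$ in the factorization of the nonzero integer $m$. Then $p_3(a_1,\ell^2;\ell^2n+a_2)=0$ for every integer $n\ge 0$. 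-/

import Mathlib

/-- The Ferrers--Young diagram of a partition `l` of `n`: its rows, from top to bottom, have as
lengths the parts of `l` in weakly decreasing order. Nodes are pairs `(i, j)` (row, column),
both counted from `0`. -/
def partitionDiagram {n : ℕ} (l : n.Partition) : YoungDiagram :=
  YoungDiagram.ofRowLens (l.parts.sort (· ≥ ·)) (l.parts.pairwise_sort (· ≥ ·)).sortedGE

/-- The hook length (arm + leg + 1) of the node `c = (i, j)` of a Young diagram. With `0`-based
coordinates the arm is `rowLen i - (j + 1)` and the leg is `colLen j - (i + 1)`; for nodes of the
diagram neither subtraction truncates (see `hookLength_eq`). -/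
def hookLength (D : YoungDiagram) (c : ℕ × ℕ) : ℕ :=
  (D.rowLen c.1 - (c.2 + 1)) + (D.colLen c.2 - (c.1 + 1)) + 1

/-- The formula `h(k, j) = (λ_k - k) + (λ'_j - j) + 1`, for the node
`c = (k - 1, j - 1)` in row `k` and column `j` (counted from `1`). -/
theorem hookLength_eq (D : YoungDiagram) (c : ℕ × ℕ) (hc : c ∈ D) :
    (hookLength D c : ℤ) =
      ((D.rowLen c.1 : ℤ) - ((c.1 : ℤ) + 1)) + ((D.colLen c.2 : ℤ) - ((c.2 : ℤ) + 1)) + 1 := by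
  have h1 : c.2 < D.rowLen c.1 := YoungDiagram.mem_iff_lt_rowLen.1 hc
  have h2 : c.1 < D.colLen c.2 := YoungDiagram.mem_iff_lt_colLen.1 hc
  unfold hookLength
  omega

/-- The multiset `H(l)` of all hook lengths of the partition `l`, one for each node. -/
def hookLengths {n : ℕ} (l : n.Partition) : Multiset ℕ :=
  (partitionDiagram l).cells.val.map (hookLength (partitionDiagram l))

/-- The multiset `H_t(l)` of `t`-hooks: the hook lengths that are multiples of `t`. -/
def tHooks (t : ℕ) {n : ℕ} (l : n.Partition) : Multiset ℕ :=
  (hookLengths l).filter (fun h => t ∣ h)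

/-- `p_t(a, b; n)`: the number of partitions `l` of `n` with `#H_t(l) ≡ a (mod b)`. -/
def tHookCount (t a b n : ℕ) : ℕ :=
  (Finset.univ.filter (fun l : n.Partition => (tHooks t l).card ≡ a [MOD b])).card

open Finset

/-! On the `t`-abacus, hooks of length divisible by `t` are pairs of a bead and a lower gap on the
same runner. Sliding all beads down shows that the size is `t * #H_t` plus the size of the `t`-core,
a quadratic polynomial in the runner counts. Completing the square makes `8n + 1 - 16 #H_2` a square
and `3n + 1 - 9 #H_3` a value of `x² + xy + y²`. The first cannot be a nonresidue mod `ℓ`; the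
second cannot be exactly divisible by an inert prime `ℓ`. -/

theorem Finset.sum_card_filter_lt (S : Finset ℕ) :
    ∑ x ∈ S, (S.filter (· < x)).card = S.card.choose 2 := by
  induction S using Finset.induction_on_max with
  | empty => simp
  | insert a s ha ih =>
    have hn : a ∉ s := fun h => lt_irrefl _ (ha a h)
    rw [sum_insert hn, card_insert_of_notMem hn, Nat.choose_succ_succ', ← ih]
    congr 1
    · rw [Nat.choose_one_right, filter_insert, if_neg (lt_irrefl _), filter_true_of_mem ha]
    · refine sum_congr rfl fun x hx => ?_
      rw [filter_insert, if_neg (by have := ha x hx; omega)]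

/-! ### Counting on the abacus -/

/-- The number of beads of the beta-set `X` on the runner `r` of its `t`-abacus. -/
def runnerCard (t : ℕ) (X : Finset ℕ) (r : ℕ) : ℕ := (X.filter (fun x => x % t = r)).card

/-- The pairs of a bead and a lower gap on the same runner of the `t`-abacus of `X`. -/
def beadGapPairs (t : ℕ) (X : Finset ℕ) : Finset (Σ _ : ℕ, ℕ) :=
  X.sigma fun x => (range x).filter fun y => y ∉ X ∧ y % t = x % t

theorem card_range_filter_mod (t x : ℕ) (ht : 0 < t) :
    ((range x).filter fun y => y % t = x % t).card = x / t := by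
  have h := Nat.count_modEq_card x ht x
  rw [Nat.count_eq_card_filter_range, if_neg (lt_irrefl _), add_zero] at h
  exact h

theorem sum_runnerCard (t : ℕ) (ht : 0 < t) (X : Finset ℕ) :
    ∑ r ∈ range t, runnerCard t X r = X.card :=
  (card_eq_sum_card_fiberwise fun x _ => by simpa using Nat.mod_lt x ht).symm

/-- Write `x = t * (x / t) + x % t`. The `x / t` positions below `x` on its runner are gaps or
beads, and the pairs of beads on a runner with `c` beads number `c.choose 2`. -/
theorem sum_eq_card_beadGapPairs (t : ℕ) (ht : 0 < t) (X : Finset ℕ) :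
    ∑ x ∈ X, x = t * (beadGapPairs t X).card +
      ∑ r ∈ range t, (t * (runnerCard t X r).choose 2 + r * runnerCard t X r) := by
  have hmaps : ∀ x ∈ X, x % t ∈ range t := fun x _ => by simpa using Nat.mod_lt x ht
  have h1 : ∑ r ∈ range t, (runnerCard t X r).choose 2 =
      ∑ x ∈ X, ((range x).filter fun y => y ∈ X ∧ y % t = x % t).card := by
    rw [← sum_fiberwise_of_maps_to hmaps]
    refine sum_congr rfl fun r _ => ?_
    rw [runnerCard, ← sum_card_filter_lt]
    refine sum_congr rfl fun x hx => congrArg card ?_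
    ext y
    simp only [mem_filter, mem_range] at hx ⊢
    rw [hx.2]
    tauto
  have h2 : ∑ r ∈ range t, r * runnerCard t X r = ∑ x ∈ X, x % t := by
    rw [← sum_fiberwise_of_maps_to hmaps]
    refine sum_congr rfl fun r _ => ?_
    rw [sum_congr rfl fun x hx => (mem_filter.1 hx).2, sum_const, smul_eq_mul, mul_comm]
    rfl
  rw [sum_add_distrib, ← mul_sum, h1, h2, beadGapPairs, card_sigma, ← add_assoc, ← mul_add,
    ← sum_add_distrib, mul_sum, ← sum_add_distrib]
  refine sum_congr rfl fun x _ => ?_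
  have h3 : ((range x).filter fun y => y ∉ X ∧ y % t = x % t).card +
      ((range x).filter fun y => y ∈ X ∧ y % t = x % t).card = x / t := by
    rw [← card_range_filter_mod t x ht,
      ← card_filter_add_card_filter_not (s := (range x).filter fun y => y % t = x % t) (· ∉ X)]
    simp only [filter_filter, not_not]
    simp only [and_comm]
  rw [h3, Nat.div_add_mod]

/-! ### Beads and gaps of a Young diagram -/

namespace YoungDiagram

/-- The first-column hook lengths of the diagram, indexed by its rows. -/
def bead (D : YoungDiagram) (i : ℕ) : ℕ := D.rowLen i + (D.colLen 0 - 1 - i)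

/-- The position on the abacus of the gap belonging to the column `j`. -/
def gap (D : YoungDiagram) (j : ℕ) : ℕ := D.colLen 0 + j - D.colLen j

/-- The set of first-column hook lengths of the diagram. -/
def betaSet (D : YoungDiagram) : Finset ℕ := (range (D.colLen 0)).image D.bead

theorem bead_lt_bead (D : YoungDiagram) {i k : ℕ} (hik : i < k) (hk : k < D.colLen 0) :
    D.bead k < D.bead i := by
  have := D.rowLen_anti i k hik.le
  unfold bead
  omega

theorem gap_lt_gap (D : YoungDiagram) {j k : ℕ} (hjk : j < k) : D.gap j < D.gap k := by
  have := D.colLen_anti j k hjk.le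
  have := D.colLen_anti 0 j j.zero_le
  unfold gap
  omega

theorem bead_injOn (D : YoungDiagram) : Set.InjOn D.bead (range (D.colLen 0)) := by
  intro i hi k hk h
  simp only [coe_range, Set.mem_Iio] at hi hk
  rcases lt_trichotomy i k with hl | hl | hl
  · have := D.bead_lt_bead hl hk; omega
  · exact hl
  · have := D.bead_lt_bead hl hi; omega

theorem gap_injective (D : YoungDiagram) : Function.Injective D.gap :=
  (strictMono_nat_of_lt_succ fun j => D.gap_lt_gap j.lt_succ_self).injective

theorem gap_lt_bead (D : YoungDiagram) {i j : ℕ} (h : (i, j) ∈ D) : D.gap j < D.bead i := by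
  have h1 := mem_iff_lt_rowLen.1 h
  have h2 := mem_iff_lt_colLen.1 h
  have := D.colLen_anti 0 j j.zero_le
  unfold gap bead
  omega

theorem bead_lt_gap (D : YoungDiagram) {i j : ℕ} (hi : i < D.colLen 0) (h : (i, j) ∉ D) :
    D.bead i < D.gap j := by
  have h1 := mt mem_iff_lt_rowLen.2 h
  have h2 := mt mem_iff_lt_colLen.2 h
  have := D.colLen_anti 0 j j.zero_le
  unfold gap bead
  omega

theorem hookLength_eq_bead_sub_gap (D : YoungDiagram) {i j : ℕ} (h : (i, j) ∈ D) :
    hookLength D (i, j) = D.bead i - D.gap j := by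
  have h1 := mem_iff_lt_rowLen.1 h
  have h2 := mem_iff_lt_colLen.1 h
  have := D.colLen_anti 0 j j.zero_le
  unfold gap bead hookLength
  dsimp only
  omega

theorem gap_notMem_betaSet (D : YoungDiagram) (j : ℕ) : D.gap j ∉ D.betaSet := by
  intro h
  obtain ⟨i, hi, h⟩ := mem_image.1 h
  by_cases hD : (i, j) ∈ D
  · have := D.gap_lt_bead hD; omega
  · have := D.bead_lt_gap (mem_range.1 hi) hD; omega

theorem card_betaSet (D : YoungDiagram) : D.betaSet.card = D.colLen 0 := by
  rw [betaSet, card_image_of_injOn D.bead_injOn, card_range]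

theorem bead_lt (D : YoungDiagram) {i : ℕ} (hi : i < D.colLen 0) :
    D.bead i < D.colLen 0 + D.rowLen 0 := by
  have := D.rowLen_anti 0 i i.zero_le
  unfold bead
  omega

/-- Disjointness and a cardinality count suffice. So each non-bead below some bead is the gap of a
column, which makes the hook bijection surjective. -/
theorem betaSet_union_gaps (D : YoungDiagram) :
    D.betaSet ∪ (range (D.rowLen 0)).image D.gap = range (D.colLen 0 + D.rowLen 0) := by
  refine eq_of_subset_of_card_le ?_ ?_
  · intro x hx
    rw [mem_range]
    rcases mem_union.1 hx with hx | hx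
    · obtain ⟨i, hi, rfl⟩ := mem_image.1 hx
      exact D.bead_lt (mem_range.1 hi)
    · obtain ⟨j, hj, rfl⟩ := mem_image.1 hx
      rw [mem_range] at hj
      unfold gap
      omega
  · rw [card_union_of_disjoint, card_betaSet, card_image_of_injective _ D.gap_injective,
      card_range, card_range]
    rw [disjoint_right]
    intro x hx
    obtain ⟨j, _, rfl⟩ := mem_image.1 hx
    exact D.gap_notMem_betaSet j

/-- A hook length is bead minus gap, so `t` divides it exactly when both lie on one runner. -/
theorem card_filter_dvd_hookLength (D : YoungDiagram) (t : ℕ) :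
    (D.cells.filter fun c => t ∣ hookLength D c).card = (beadGapPairs t D.betaSet).card := by
  refine card_bij (fun c _ => ⟨D.bead c.1, D.gap c.2⟩) ?_ ?_ ?_
  · rintro ⟨i, j⟩ h
    rw [mem_filter, mem_cells] at h
    have hlt := D.gap_lt_bead h.1
    rw [D.hookLength_eq_bead_sub_gap h.1] at h
    have hi : i < D.colLen 0 :=
      (mem_iff_lt_colLen.1 h.1).trans_le (D.colLen_anti 0 j j.zero_le)
    simp only [beadGapPairs, mem_sigma, mem_filter, mem_range]
    exact ⟨mem_image_of_mem _ (mem_range.2 hi), hlt, D.gap_notMem_betaSet j,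
      (Nat.modEq_iff_dvd' hlt.le).2 h.2⟩
  · rintro ⟨i, j⟩ h ⟨i', j'⟩ h' heq
    rw [mem_filter, mem_cells] at h h'
    have hi : ∀ {i j}, (i, j) ∈ D → i ∈ range (D.colLen 0) := fun {i j} h =>
      mem_range.2 ((mem_iff_lt_colLen.1 h).trans_le (D.colLen_anti 0 j j.zero_le))
    simp only [Sigma.mk.injEq, heq_eq_eq] at heq
    exact Prod.ext (D.bead_injOn (hi h.1) (hi h'.1) heq.1) (D.gap_injective heq.2)
  · rintro ⟨x, y⟩ h
    simp only [beadGapPairs, mem_sigma, mem_filter, mem_range] at h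
    obtain ⟨hx, hlt, hy, hmod⟩ := h
    obtain ⟨i, hi, rfl⟩ := mem_image.1 hx
    rw [mem_range] at hi
    have hyr : y ∈ D.betaSet ∪ (range (D.rowLen 0)).image D.gap := by
      rw [betaSet_union_gaps, mem_range]
      exact hlt.trans (D.bead_lt hi)
    obtain ⟨j, _, rfl⟩ := mem_image.1 ((mem_union.1 hyr).resolve_left hy)
    have hD : (i, j) ∈ D := by
      by_contra hD
      have := D.bead_lt_gap hi hD
      omega
    refine ⟨(i, j), ?_, rfl⟩
    rw [mem_filter, mem_cells, D.hookLength_eq_bead_sub_gap hD]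
    exact ⟨hD, (Nat.modEq_iff_dvd' hlt.le).1 hmod⟩

theorem sum_betaSet (D : YoungDiagram) :
    ∑ x ∈ D.betaSet, x = ∑ i ∈ range (D.colLen 0), D.rowLen i + (D.colLen 0).choose 2 := by
  rw [betaSet, sum_image D.bead_injOn, Nat.choose_two_right, ← sum_range_id]
  simp only [bead]
  rw [sum_add_distrib, sum_range_reflect (fun i => i)]

end YoungDiagram

theorem sum_rowLen_partitionDiagram {n : ℕ} (l : n.Partition) :
    ∑ i ∈ range ((partitionDiagram l).colLen 0), (partitionDiagram l).rowLen i = n := by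
  have h : (partitionDiagram l).rowLens = l.parts.sort (· ≥ ·) :=
    YoungDiagram.rowLens_ofRowLens_eq_self fun x hx =>
      l.parts_pos ((Multiset.mem_sort _).1 hx)
  have h2 := congrArg List.sum h
  rw [← Multiset.sum_coe (l.parts.sort _), Multiset.sort_eq, l.parts_sum] at h2
  exact h2

/-- The size of a partition in terms of its `t`-hooks and the runners of its `t`-abacus. -/
theorem partition_size_eq {n : ℕ} (l : n.Partition) (t : ℕ) (ht : 0 < t) :
    ∃ c : ℕ → ℕ, n + (∑ r ∈ range t, c r).choose 2 =
      t * (tHooks t l).card + ∑ r ∈ range t, (t * (c r).choose 2 + r * c r) := by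
  refine ⟨runnerCard t (partitionDiagram l).betaSet, ?_⟩
  have hc : (tHooks t l).card = (beadGapPairs t (partitionDiagram l).betaSet).card := by
    rw [← YoungDiagram.card_filter_dvd_hookLength, tHooks, hookLengths, Multiset.filter_map,
      Multiset.card_map]
    rfl
  rw [hc, ← sum_eq_card_beadGapPairs t ht, sum_runnerCard t ht, YoungDiagram.card_betaSet,
    YoungDiagram.sum_betaSet, sum_rowLen_partitionDiagram]

/-! ### Quadratic forms for `t = 2, 3` -/

theorem Int.two_mul_choose_two (n : ℕ) : 2 * ((n.choose 2 : ℕ) : ℤ) = n * (n - 1) := by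
  induction n with
  | zero => simp
  | succ k ih =>
    rw [Nat.choose_succ_succ', Nat.choose_one_right]
    push_cast
    linarith

theorem eight_mul_add_one_eq_sq {n : ℕ} (l : n.Partition) :
    ∃ x : ℤ, 8 * (n : ℤ) + 1 = 16 * ((tHooks 2 l).card : ℤ) + x ^ 2 := by
  obtain ⟨c, h⟩ := partition_size_eq l 2 two_pos
  simp only [sum_range_succ, sum_range_zero, zero_add, zero_mul, add_zero, one_mul] at h
  have h0 := Int.two_mul_choose_two (c 0)
  have h1 := Int.two_mul_choose_two (c 1)
  have hs := Int.two_mul_choose_two (c 0 + c 1)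
  zify at h
  push_cast at hs
  refine ⟨2 * (c 0 - c 1) - 1, ?_⟩
  linear_combination 8 * h + 8 * h0 + 8 * h1 - 4 * hs

theorem three_mul_add_one_eq_norm {n : ℕ} (l : n.Partition) :
    ∃ x y : ℤ, 3 * (n : ℤ) + 1 = 9 * ((tHooks 3 l).card : ℤ) + (x ^ 2 + x * y + y ^ 2) := by
  obtain ⟨c, h⟩ := partition_size_eq l 3 three_pos
  simp only [sum_range_succ, sum_range_zero, zero_add, zero_mul, add_zero, one_mul] at h
  have h0 := Int.two_mul_choose_two (c 0)
  have h1 := Int.two_mul_choose_two (c 1)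
  have h2 := Int.two_mul_choose_two (c 2)
  have hs := Int.two_mul_choose_two (c 0 + c 1 + c 2)
  zify at h
  push_cast at hs
  -- Only differences of the `c r` occur: one more bead on every runner leaves the core unchanged.
  refine ⟨c 0 + c 1 - 2 * c 2 - 1, c 0 - 2 * c 1 + c 2, ?_⟩
  refine mul_left_cancel₀ two_ne_zero ?_
  linear_combination 6 * h + 9 * h0 + 9 * h1 + 9 * h2 - 3 * hs

/-- A prime congruent to `2` modulo `3` is inert in the Eisenstein integers. -/
theorem dvd_of_dvd_sq_add_mul_add_sq {p : ℕ} (hp : p.Prime) (hp3 : p ≡ 2 [MOD 3]) {x y : ℤ}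
    (h : (p : ℤ) ∣ x ^ 2 + x * y + y ^ 2) : (p : ℤ) ∣ x ∧ (p : ℤ) ∣ y := by
  have := Fact.mk hp
  have key : ∀ u v : ZMod p, u ^ 2 + u * v + v ^ 2 = 0 → v = 0 := by
    intro u v huv
    by_contra hv
    have hu : u ≠ 0 := by
      rintro rfl
      exact hv (by simpa using huv)
    -- Cubing is injective on units because `p - 1 = 3k + 1`; hence `u = v` and `3u² = 0`.
    have h3 : u ^ 3 = v ^ 3 := by linear_combination (u - v) * huv
    obtain ⟨k, hk⟩ : ∃ k, p = 3 * k + 2 := ⟨p / 3, by unfold Nat.ModEq at hp3; omega⟩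
    have hfu := ZMod.pow_card_sub_one_eq_one hu
    have hfv := ZMod.pow_card_sub_one_eq_one hv
    have hk1 : p - 1 = 3 * k + 1 := by omega
    rw [hk1, pow_succ, pow_mul] at hfu hfv
    have huv' : u = v := by
      rw [h3] at hfu
      exact mul_left_cancel₀ (pow_ne_zero k (pow_ne_zero 3 hv)) (hfu.trans hfv.symm)
    subst huv'
    have h3u : (3 : ZMod p) * u ^ 2 = 0 := by linear_combination huv
    have h30 : ((3 : ℕ) : ZMod p) = 0 := by
      exact_mod_cast (mul_eq_zero.1 h3u).resolve_right (pow_ne_zero 2 hu)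
    rw [ZMod.natCast_eq_zero_iff, Nat.prime_dvd_prime_iff_eq hp Nat.prime_three] at h30
    omega
  have hz := (ZMod.intCast_zmod_eq_zero_iff_dvd _ p).2 h
  push_cast at hz
  exact ⟨(ZMod.intCast_zmod_eq_zero_iff_dvd _ p).1 (key y x (by linear_combination hz)),
    (ZMod.intCast_zmod_eq_zero_iff_dvd _ p).1 (key x y hz)⟩

theorem theorem1p3 :
    (∀ (ℓ : ℕ) [Fact ℓ.Prime] (a₁ a₂ : ℕ), ℓ ≠ 2 → a₁ < ℓ → a₂ < ℓ →
      legendreSym ℓ (-16 * (a₁ : ℤ) + 8 * (a₂ : ℤ) + 1) = -1 →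
      ∀ n : ℕ, tHookCount 2 a₁ ℓ (ℓ * n + a₂) = 0) ∧
    (∀ (ℓ a₁ a₂ : ℕ), ℓ.Prime → ℓ ≡ 2 [MOD 3] → a₁ < ℓ ^ 2 → a₂ < ℓ ^ 2 →
      padicValInt ℓ (-9 * (a₁ : ℤ) + 3 * (a₂ : ℤ) + 1) = 1 →
      ∀ n : ℕ, tHookCount 3 a₁ (ℓ ^ 2) (ℓ ^ 2 * n + a₂) = 0) := by
  constructor
  · intro ℓ _ a₁ a₂ _ _ _ hleg n
    rw [tHookCount, card_eq_zero, filter_eq_empty_iff]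
    intro l _ hl
    obtain ⟨x, hx⟩ := eight_mul_add_one_eq_sq l
    refine (legendreSym.eq_neg_one_iff ℓ).1 hleg ⟨(x : ZMod ℓ), ?_⟩
    have hl' := (ZMod.natCast_eq_natCast_iff _ _ _).2 hl
    have hx' := congrArg (Int.cast : ℤ → ZMod ℓ) hx
    push_cast at hx' ⊢
    rw [ZMod.natCast_self] at hx'
    linear_combination hx' + 16 * hl'
  · intro ℓ a₁ a₂ hℓ hℓ3 _ _ hord n
    have := Fact.mk hℓ
    rw [tHookCount, card_eq_zero, filter_eq_empty_iff]
    intro l _ hl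
    obtain ⟨x, y, hxy⟩ := three_mul_add_one_eq_norm l
    obtain ⟨d, hd⟩ := Nat.modEq_iff_dvd.1 hl
    -- It is `1` mod `3`.
    have hne : -9 * (a₁ : ℤ) + 3 * (a₂ : ℤ) + 1 ≠ 0 := by omega
    push_cast at hxy hd
    have hxy' : x ^ 2 + x * y + y ^ 2 =
        -9 * (a₁ : ℤ) + 3 * (a₂ : ℤ) + 1 + (ℓ : ℤ) ^ 2 * (3 * n + 9 * d) := by
      linear_combination -hxy + 9 * hd
    have hdvd : (ℓ : ℤ) ∣ -9 * (a₁ : ℤ) + 3 * (a₂ : ℤ) + 1 := by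
      have := (padicValInt_dvd_iff 1 (p := ℓ) (-9 * (a₁ : ℤ) + 3 * (a₂ : ℤ) + 1)).2
        (Or.inr hord.ge)
      simpa using this
    obtain ⟨⟨u, rfl⟩, ⟨v, rfl⟩⟩ := dvd_of_dvd_sq_add_mul_add_sq hℓ hℓ3
      (hxy' ▸ hdvd.add (Dvd.intro (ℓ * (3 * n + 9 * d) : ℤ) (by ring)))
    have h2 : (ℓ : ℤ) ^ 2 ∣ -9 * (a₁ : ℤ) + 3 * (a₂ : ℤ) + 1 :=
      ⟨u ^ 2 + u * v + v ^ 2 - (3 * n + 9 * d), by linear_combination -hxy'⟩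
    have := ((padicValInt_dvd_iff 2 _).1 h2).resolve_left hne
    omega
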